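/- Let $\mathbb T=\mathbb R/\mathbb Z$ (with Haar measure of mass one), let $\mathcal M(\mathbb T)=C(\mathbb T)^*$ be the space of real Radon measures with the total variation norm $\|\cdot\|_{TV}$, and let $\varphi\in C^2(\mathbb T,\mathbb R)$. Define $\Phi:\mathcal M(\mathbb T)\to L^2(\mathbb T)$ and $\Phi^*:L^2(\mathbb T)\to C(\mathbb T)$ by $$\Phi m(t)=\int_{\mathbb T}\varphi(x-t)\,dm(x),\qquad \Phi^*p(t)=\int_{\mathbb T}\varphi(t-x)p(x)\,dx .$$ Let $m_0=\sum_{i=1}^N a_{0,i}\delta_{x_{0,i}}$ with all $a_{0,i}\in\mathbb R\setminus\{0\}$ and the $x_{0,i}\in\mathbb T$ pairwise distinct, and let $y=\Phi m_0$. Let $\Gamma_{x_0}:\mathbb R^N\times\mathbb R^N\to L^2(\mathbb T)$, $$\Gamma_{x_0}(u,v)=\sum_{i=1}^N\bigl(u_i\,\varphi(x_{0,i}-\cdot)+v_i\,\varphi'(x_{0,i}-\cdot)\bigr).$$ The minimal-norm certificate is $\eta_0=\Phi^*p_0$, where $p_0$ is the solution of minimal $L^2$ norm of the dual problem $\sup\{\langle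 y,p\rangle:\ p\in L^2(\mathbb T),\ \|\Phi^*p\|_\infty\le 1\}$. The vanishing derivative pre-certificate is $\eta_V=\Phi^*p_V$, where $p_V$ has minimal $L^2$ norm among all $p\in L^2(\mathbb T)$ such that $(\Phi^*p)(x_{0,i})=\operatorname{sign}(a_{0,i})$ and $(\Phi^*p)'(x_{0,i})=0$ for $1\le i\le N$. Assume that $\Gamma_{x_0}$ has full rank (is injective) and that $m_0$ satisfies the Non Degenerate Source Condition: there is $p\in L^2(\mathbb T)$ with $\Phi^*p\in\partial\|m_0\|_{TV}$, i.e. $\|m\|_{TV}\ge\|m_0\|_{TV}+\int\Phi^*p\,d(m-m_0)$ for all $m\in\mathcal M(\mathbb T)$; and the minimal-norm certificate satisfies $|\eta_0(s)|<1$ for all $s\in\mathbb T\setminus\{x_{0,1},\dots,x_{0,N}\}$ and $\eta_0''(x_{0,i})\ne0$ for all $i$. Then $p_0$ and $p_V$ exist and are unique, $\Gamma_{x_0}^*\Gamma_{x_0}$ is invertible, and $$\eta_V=\eta_0=\Phi^*\,\Gamma_{x_0}(\Gamma_{x_0}^*\Gamma_{x_0})^{-1}\begin{pmatrix}\operatorname{sign}(a_0)\\0\end{pmatrix}.$$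 -/

import Mathlib

noncomputable section

open MeasureTheory

namespace SparseSpikes

/-- The one-dimensional torus `𝕋 = ℝ / ℤ`, with its Haar measure of total mass one. -/
abbrev Torus : Type := UnitAddCircle

/-- The real Hilbert space `L²(𝕋)`. -/
abbrev L2 : Type := Lp ℝ 2 (volume : Measure Torus)

/-- Radon measures on `𝕋`: the dual of `C(𝕋)`. The dual norm is the total variation,
and the value `m ψ` is the integral of `ψ` against `m`. -/
abbrev RadonMeasure : Type := C(Torus, ℝ) →L[ℝ] ℝ

/-- The derivative of a function on the torus. -/
def torusDeriv (g : Torus → ℝ) (x : Torus) : ℝ :=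
  deriv (fun h : ℝ => g (x + (h : Torus))) 0

/-- Functions of class `C²` on the torus: those whose `1`-periodic lift to `ℝ` is `C²`. -/
structure C2Torus where
  toFun : Torus → ℝ
  contDiff : ContDiff ℝ 2 (fun t : ℝ => toFun (t : Torus))

namespace C2Torus

theorem continuous_of_lift {g : Torus → ℝ} (h : Continuous (fun t : ℝ => g (t : Torus))) :
    Continuous g :=
  (QuotientAddGroup.isQuotientMap_mk (N := AddSubgroup.zmultiples (1 : ℝ))).continuous_iff.2 h

theorem torusDeriv_coe (g : Torus → ℝ) (t : ℝ) :
    torusDeriv g (t : Torus) = deriv (fun s : ℝ => g (s : Torus)) t := by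
  have h := deriv_comp_const_add (f := fun s : ℝ => g (s : Torus)) t 0
  simp only [add_zero] at h
  rw [← h, torusDeriv]
  simp only [AddCircle.coe_add]

/-- The function itself, as an element of `C(𝕋)`. -/
def cont (φ : C2Torus) : C(Torus, ℝ) :=
  ⟨φ.toFun, continuous_of_lift φ.contDiff.continuous⟩

/-- The derivative `φ'`, as an element of `C(𝕋)`. -/
def contDeriv (φ : C2Torus) : C(Torus, ℝ) :=
  ⟨torusDeriv φ.toFun, continuous_of_lift (by
    simp only [torusDeriv_coe]
    exact φ.contDiff.continuous_deriv (by norm_num))⟩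

end C2Torus

/-- The operator `Φ : 𝓜(𝕋) → L²(𝕋)`, `Φ m : t ↦ ∫ φ(x - t) dm(x)`. -/
def Phi (φ : C2Torus) (m : RadonMeasure) : L2 :=
  ContinuousMap.toLp 2 volume ℝ
    ⟨fun t : Torus => m ⟨fun x : Torus => φ.cont (x - t), by fun_prop⟩,
      m.continuous.comp (ContinuousMap.curry
        ⟨fun q : Torus × Torus => φ.cont (q.2 - q.1), by fun_prop⟩).continuous⟩

theorem continuous_phiAdj (φ : C2Torus) (p : L2) :
    Continuous (fun t : Torus => ∫ x : Torus, φ.cont (t - x) * p x) := by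
  have hp : Integrable (fun x : Torus => p x) volume :=
    (Lp.memLp p).integrable (by norm_num)
  refine continuous_of_dominated (bound := fun x => ‖φ.cont‖ * ‖p x‖) ?_ ?_ ?_ ?_
  · intro t
    have h : Continuous (fun x : Torus => φ.cont (t - x)) := by fun_prop
    exact h.aestronglyMeasurable.mul hp.aestronglyMeasurable
  · intro t
    refine Filter.Eventually.of_forall fun x => ?_
    rw [norm_mul]
    exact mul_le_mul_of_nonneg_right (φ.cont.norm_coe_le_norm _) (norm_nonneg _)
  · exact hp.norm.const_mul _
  · refine Filter.Eventually.of_forall fun x => ?_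
    fun_prop

/-- The adjoint `Φ* : L²(𝕋) → C(𝕋)`, `Φ* p : t ↦ ∫ φ(t - x) p(x) dx`. -/
def PhiAdj (φ : C2Torus) (p : L2) : C(Torus, ℝ) :=
  ⟨fun t : Torus => ∫ x : Torus, φ.cont (t - x) * p x, continuous_phiAdj φ p⟩

/-- The discrete measure `m_{a,x} = ∑ᵢ aᵢ δ_{xᵢ}`. -/
def discreteMeasure {N : ℕ} (a : Fin N → ℝ) (x : Fin N → Torus) : RadonMeasure :=
  ∑ i, a i • ContinuousMap.evalCLM ℝ (x i)

/-- The subdifferential of the total variation at `m`. -/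
def subdiffTV (m : RadonMeasure) : Set C(Torus, ℝ) :=
  {η | ∀ m' : RadonMeasure, ‖m‖ + (m' - m) η ≤ ‖m'‖}

/-- The solutions of the dual problem `sup {⟨y, p⟩ : ‖Φ* p‖_∞ ≤ 1}`. -/
def dualSolutions (φ : C2Torus) (y : L2) : Set L2 :=
  {p | ‖PhiAdj φ p‖ ≤ 1 ∧ ∀ q : L2, ‖PhiAdj φ q‖ ≤ 1 → inner ℝ y q ≤ inner ℝ y p}

/-- `p` is an element of minimal norm of `S`. -/
def IsMinNorm (S : Set L2) (p : L2) : Prop :=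
  p ∈ S ∧ ∀ q ∈ S, ‖p‖ ≤ ‖q‖

/-- `η₀ = Φ* p₀`, where `p₀` is the dual solution of minimal norm for the observation `y`. -/
def IsMinNormCertificate (φ : C2Torus) (y : L2) (η₀ : C(Torus, ℝ)) : Prop :=
  ∃ p₀, IsMinNorm (dualSolutions φ y) p₀ ∧ η₀ = PhiAdj φ p₀

/-- The constraints `(Φ* p)(xᵢ) = sign aᵢ` and `(Φ* p)'(xᵢ) = 0`. -/
def vanishingConstraints (φ : C2Torus) {N : ℕ} (a : Fin N → ℝ) (x : Fin N → Torus) : Set L2 :=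
  {p | ∀ i, PhiAdj φ p (x i) = Real.sign (a i) ∧ torusDeriv (PhiAdj φ p) (x i) = 0}

/-- `ηV = Φ* pV`, where `pV` has minimal norm among the `p` satisfying the constraints. -/
def IsVanishingDerivativePrecertificate (φ : C2Torus) {N : ℕ} (a : Fin N → ℝ)
    (x : Fin N → Torus) (ηV : C(Torus, ℝ)) : Prop :=
  ∃ pV, IsMinNorm (vanishingConstraints φ a x) pV ∧ ηV = PhiAdj φ pV

/-- The source condition: some `Φ* p` lies in the subdifferential of the total variation. -/
def SourceCondition (φ : C2Torus) (m : RadonMeasure) : Prop :=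
  ∃ p : L2, PhiAdj φ p ∈ subdiffTV m

/-- The non degenerate source condition for `m_{a,x}`. The minimal-norm certificate exists and
is unique as soon as the source condition holds. -/
def NonDegenerateSourceCondition (φ : C2Torus) {N : ℕ} (a : Fin N → ℝ)
    (x : Fin N → Torus) : Prop :=
  SourceCondition φ (discreteMeasure a x) ∧
    ∀ η₀, IsMinNormCertificate φ (Phi φ (discreteMeasure a x)) η₀ →
      (∀ s, s ∉ Set.range x → |η₀ s| < 1) ∧
        ∀ i, torusDeriv (torusDeriv η₀) (x i) ≠ 0

/-- The function `t ↦ ψ(x - t)` as an element of `L²(𝕋)`. -/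
def atom (ψ : C(Torus, ℝ)) (x : Torus) : L2 :=
  ContinuousMap.toLp 2 volume ℝ ⟨fun t : Torus => ψ (x - t), by fun_prop⟩

/-- The operator `a ↦ ∑ᵢ aᵢ ψ(xᵢ - ·)`; it is `Φ_x` for `ψ = φ` and `Φ'_x` for `ψ = φ'`. -/
def spikeOp (ψ : C(Torus, ℝ)) {N : ℕ} (x : Fin N → Torus) :
    EuclideanSpace ℝ (Fin N) →L[ℝ] L2 :=
  ∑ i, (EuclideanSpace.proj i : EuclideanSpace ℝ (Fin N) →L[ℝ] ℝ).smulRight (atom ψ (x i))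

/-- The Euclidean space `ℝᴺ × ℝᴺ = ℝ²ᴺ`. -/
abbrev PairSpace (N : ℕ) : Type :=
  WithLp 2 (EuclideanSpace ℝ (Fin N) × EuclideanSpace ℝ (Fin N))

/-- `Γ_x = (Φ_x, Φ'_x) : (u, v) ↦ Φ_x u + Φ'_x v`. -/
def Gam (φ : C2Torus) {N : ℕ} (x : Fin N → Torus) : PairSpace N →L[ℝ] L2 :=
  spikeOp φ.cont x ∘L WithLp.fstL 2 ℝ _ _ + spikeOp φ.contDeriv x ∘L WithLp.sndL 2 ℝ _ _

/-- `Γ_x* Γ_x`, an endomorphism of `ℝ²ᴺ`. -/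
def gramGam (φ : C2Torus) {N : ℕ} (x : Fin N → Torus) : PairSpace N →L[ℝ] PairSpace N :=
  ContinuousLinearMap.adjoint (Gam φ x) ∘L Gam φ x

/-- The vector `(sign a, 0)` of `ℝ²ᴺ`. -/
def signZero {N : ℕ} (a : Fin N → ℝ) : PairSpace N :=
  WithLp.toLp 2 (WithLp.toLp 2 (fun i => Real.sign (a i)), 0)

end SparseSpikes

end

noncomputable section

open MeasureTheory Filter Topology

namespace SparseSpikes

/-! ### Correlation of an `L²` function with the translates of a kernel -/

/-! The dual solutions are the `p` with `|Φ* p| ≤ 1` that interpolate the signs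
(`mem_dualSolutions_iff`). Each spike is then an extremum of `Φ* p`, so these `p` form a subset of
`vanishingConstraints`. This subset is in general proper, but non degeneracy makes it large enough
around `p₀`: for `q` in the larger set, `p₀ + ε(q - p₀)` is still a dual solution for small `ε > 0`
(`eventually_abs_phiAdj_add_smul_le_one`). A local minimizer of a convex function on a convex set is
global, hence `p₀` also has minimal norm among the vanishing constraints. Those constraints read `Γ*
p = (sign a, 0)`; as `Γ` is injective, their least-norm solution is `Γ (Γ* Γ)⁻¹ (sign a, 0)`, and
uniqueness of minimizers identifies it with `p₀` and `pV`. -/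

theorem inner_atom (ψ : C(Torus, ℝ)) (t : Torus) (p : L2) :
    inner ℝ (atom ψ t) p = ∫ s : Torus, ψ (t - s) * p s := by
  rw [L2.inner_def]
  refine integral_congr_ae ?_
  have h := ContinuousMap.coeFn_toLp (p := 2) (𝕜 := ℝ) (volume : Measure Torus)
    (⟨fun s : Torus => ψ (t - s), by fun_prop⟩ : C(Torus, ℝ))
  filter_upwards [h] with s hs
  have hs' : (atom ψ t : L2) s = ψ (t - s) := hs
  simp [hs', mul_comm]

theorem phiAdj_apply (φ : C2Torus) (p : L2) (t : Torus) :
    PhiAdj φ p t = inner ℝ (atom φ.cont t) p :=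
  (inner_atom φ.cont t p).symm

theorem continuous_atom (ψ : C(Torus, ℝ)) : Continuous (atom ψ) :=
  (ContinuousMap.toLp 2 (volume : Measure Torus) ℝ).continuous.comp
    (ContinuousMap.curry ⟨fun q : Torus × Torus => ψ (q.1 - q.2), by fun_prop⟩).continuous

/-- Differentiation under the integral sign for `t ↦ ∫ ψ(t - s) p(s) ds`. -/
theorem hasDerivAt_inner_atom {ψ ψ' : C(Torus, ℝ)}
    (h : ∀ u : ℝ, HasDerivAt (fun v : ℝ => ψ (v : Torus)) (ψ' (u : Torus)) u) (p : L2) (u : ℝ) :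
    HasDerivAt (fun v : ℝ => inner ℝ (atom ψ (v : Torus)) p)
      (inner ℝ (atom ψ' (u : Torus)) p) u := by
  have hp : Integrable (fun s : Torus => p s) volume :=
    (Lp.memLp p).integrable (by norm_num)
  have hmeas (χ : C(Torus, ℝ)) (v : ℝ) :
      AEStronglyMeasurable (fun s : Torus => χ ((v : Torus) - s) * p s) volume := by
    have hc : Continuous (fun s : Torus => χ ((v : Torus) - s)) := by fun_prop
    exact hc.aestronglyMeasurable.mul hp.aestronglyMeasurable
  have hbound (χ : C(Torus, ℝ)) (v : ℝ) (s : Torus) :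
      ‖χ ((v : Torus) - s) * p s‖ ≤ ‖χ‖ * ‖p s‖ := by
    rw [norm_mul]
    exact mul_le_mul_of_nonneg_right (χ.norm_coe_le_norm _) (norm_nonneg _)
  have hint : Integrable (fun s : Torus => ψ ((u : Torus) - s) * p s) volume :=
    (hp.norm.const_mul ‖ψ‖).mono' (hmeas ψ u) (Eventually.of_forall fun s => hbound ψ u s)
  have hderiv (s : Torus) (v : ℝ) : HasDerivAt (fun v : ℝ => ψ ((v : Torus) - s) * p s)
      (ψ' ((v : Torus) - s) * p s) v := by
    obtain ⟨r, hr⟩ := QuotientAddGroup.mk_surjective s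
    have hd := (h (v - r)).comp_sub_const v r
    simp only [AddCircle.coe_sub] at hd
    rw [← hr]
    exact hd.mul_const _
  have key := hasDerivAt_integral_of_dominated_loc_of_deriv_le (𝕜 := ℝ) (μ := volume)
    (F := fun (v : ℝ) (s : Torus) => ψ ((v : Torus) - s) * p s)
    (F' := fun (v : ℝ) (s : Torus) => ψ' ((v : Torus) - s) * p s) (x₀ := u)
    (bound := fun s => ‖ψ'‖ * ‖p s‖) univ_mem (Eventually.of_forall (hmeas ψ)) hint
    (hmeas ψ' u) (Eventually.of_forall fun s v _ => hbound ψ' v s) (hp.norm.const_mul _)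
    (Eventually.of_forall fun s v _ => hderiv s v)
  simp only [inner_atom]
  exact key.2

namespace C2Torus

/-- The second derivative `φ''`, as an element of `C(𝕋)`. -/
def contDeriv2 (φ : C2Torus) : C(Torus, ℝ) :=
  ⟨torusDeriv (torusDeriv φ.toFun), continuous_of_lift (by
    simp only [torusDeriv_coe]
    exact ((contDiff_succ_iff_deriv (n := 1)).1 φ.contDiff).2.2.continuous_deriv le_rfl)⟩

theorem hasDerivAt_cont (φ : C2Torus) (u : ℝ) :
    HasDerivAt (fun v : ℝ => φ.cont (v : Torus)) (φ.contDeriv (u : Torus)) u := by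
  have h : φ.contDeriv (u : Torus) = deriv (fun v : ℝ => φ.toFun (v : Torus)) u :=
    torusDeriv_coe _ _
  rw [h]
  exact ((φ.contDiff.differentiable (by norm_num)) u).hasDerivAt

theorem hasDerivAt_contDeriv (φ : C2Torus) (u : ℝ) :
    HasDerivAt (fun v : ℝ => φ.contDeriv (v : Torus)) (φ.contDeriv2 (u : Torus)) u := by
  have h : φ.contDeriv2 (u : Torus) = deriv (fun v : ℝ => φ.contDeriv (v : Torus)) u :=
    torusDeriv_coe _ _
  have h' : (fun v : ℝ => φ.contDeriv (v : Torus)) = deriv (fun v : ℝ => φ.toFun (v : Torus)) :=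
    funext fun v => torusDeriv_coe _ _
  rw [h, h']
  exact ((((contDiff_succ_iff_deriv (n := 1)).1 φ.contDiff).2.2.differentiable (by norm_num))
    u).hasDerivAt

end C2Torus

theorem torusDeriv_phiAdj (φ : C2Torus) (p : L2) :
    torusDeriv (PhiAdj φ p) = fun t => inner ℝ (atom φ.contDeriv t) p := by
  funext t
  obtain ⟨r, rfl⟩ := QuotientAddGroup.mk_surjective t
  refine (C2Torus.torusDeriv_coe _ r).trans ?_
  simp only [phiAdj_apply]
  exact (hasDerivAt_inner_atom φ.hasDerivAt_cont p r).deriv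

theorem torusDeriv_torusDeriv_phiAdj (φ : C2Torus) (p : L2) :
    torusDeriv (torusDeriv (PhiAdj φ p)) = fun t => inner ℝ (atom φ.contDeriv2 t) p := by
  rw [torusDeriv_phiAdj]
  funext t
  obtain ⟨r, rfl⟩ := QuotientAddGroup.mk_surjective t
  exact (C2Torus.torusDeriv_coe _ r).trans
    (hasDerivAt_inner_atom φ.hasDerivAt_contDeriv p r).deriv

/-! ### Stability of a nondegenerate maximum -/

/-- A strictly nondegenerate maximum of value `1` survives small perturbations that vanish to
first order at the maximizer. -/
theorem eventually_abs_add_mul_le_one {f f' f'' g g' g'' : ℝ → ℝ} {u : ℝ}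
    (hf : ∀ v, HasDerivAt f (f' v) v) (hf' : ∀ v, HasDerivAt f' (f'' v) v)
    (hf'' : Continuous f'') (hg : ∀ v, HasDerivAt g (g' v) v)
    (hg' : ∀ v, HasDerivAt g' (g'' v) v) (hg'' : Continuous g'')
    (hle : ∀ v, f v ≤ 1) (hfu : f u = 1) (hne : f'' u ≠ 0) (hgu : g u = 0) (hgu' : g' u = 0) :
    ∀ᶠ z : ℝ × ℝ in 𝓝 (0, u), |f z.2 + z.1 * g z.2| ≤ 1 := by
  have hfc : Continuous f := continuous_iff_continuousAt.2 fun v => (hf v).continuousAt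
  have hgc : Continuous g := continuous_iff_continuousAt.2 fun v => (hg v).continuousAt
  have hmax : IsLocalMax f u := Eventually.of_forall fun v => (hle v).trans hfu.ge
  have hfu' : f' u = 0 := hmax.hasDerivAt_eq_zero (hf u)
  have hdf : deriv f = f' := funext fun v => (hf v).deriv
  have hdf' : deriv f' = f'' := funext fun v => (hf' v).deriv
  have hneg : f'' u < 0 := by
    -- If `f'' u > 0`, then `u` is both a local minimum and a local maximum, so `f` is locally
    -- constant and `f'' u = 0`.
    refine lt_of_le_of_ne (not_lt.1 fun hpos => ?_) hne
    have hmin : IsLocalMin f u :=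
      isLocalMin_of_deriv_deriv_pos (by rwa [hdf, hdf']) (by rw [hdf, hfu']) hfc.continuousAt
    have hconst : f =ᶠ[𝓝 u] fun _ => f u := by
      filter_upwards [hmin, hmax] with v h₁ h₂ using le_antisymm h₂ h₁
    have h₂ := hconst.deriv.deriv.eq_of_nhds
    rw [hdf, hdf'] at h₂
    simp at h₂
    exact hne h₂
  have hlow : ∀ᶠ z : ℝ × ℝ in 𝓝 (0, u), -1 < f z.2 + z.1 * g z.2 := by
    have hc : Continuous fun z : ℝ × ℝ => f z.2 + z.1 * g z.2 := by fun_prop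
    exact hc.continuousAt.eventually_const_lt (by simp [hfu])
  have hcurv : ∀ᶠ z : ℝ × ℝ in 𝓝 (0, u), f'' z.2 + z.1 * g'' z.2 < 0 := by
    have hc : Continuous fun z : ℝ × ℝ => f'' z.2 + z.1 * g'' z.2 := by fun_prop
    exact hc.continuousAt.eventually_lt_const (by simpa using hneg)
  obtain ⟨ε, hε, hball⟩ := Metric.eventually_nhds_iff_ball.1 hcurv
  filter_upwards [hlow, Metric.ball_mem_nhds _ hε] with z hz hzε
  refine abs_le.2 ⟨hz.le, ?_⟩
  rw [← ball_prod_same] at hball hzε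
  obtain ⟨hz₁, hz₂⟩ := hzε
  -- A concave function lies below its tangent at `u`, which is the constant `1` for every
  -- perturbation size `z.1`.
  have hconc : ConcaveOn ℝ (Metric.ball u ε) fun v => f v + z.1 * g v := by
    refine concaveOn_of_hasDerivWithinAt2_nonpos (f' := fun v => f' v + z.1 * g' v)
      (f'' := fun v => f'' v + z.1 * g'' v) (convex_ball u ε) (by fun_prop)
      (fun v _ => ((hf v).add ((hg v).const_mul z.1)).hasDerivWithinAt)
      (fun v _ => ((hf' v).add ((hg' v).const_mul z.1)).hasDerivWithinAt) fun v hv => ?_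
    exact (hball (z.1, v) ⟨hz₁, interior_subset hv⟩).le
  have hder : HasDerivAt (fun v => f v + z.1 * g v) 0 u := by
    have h := (hf u).add ((hg u).const_mul z.1)
    rw [hfu', hgu', mul_zero, add_zero] at h
    exact h
  have hu : u ∈ Metric.ball u ε := Metric.mem_ball_self hε
  rcases lt_trichotomy z.2 u with h | h | h
  · have hs := hconc.le_slope_of_hasDerivAt hz₂ hu h hder
    rw [slope_def_field, le_div_iff₀ (sub_pos.2 h)] at hs
    simp only [hfu, hgu] at hs
    linarith
  · rw [h, hfu, hgu]; simp
  · have hs := hconc.slope_le_of_hasDerivAt hu hz₂ h hder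
    rw [slope_def_field, div_le_iff₀ (sub_pos.2 h)] at hs
    simp only [hfu, hgu] at hs
    linarith

theorem mul_sign_eq_abs (a : ℝ) : a * Real.sign a = |a| := by
  rcases lt_trichotomy a 0 with h | h | h
  · rw [Real.sign_of_neg h, abs_of_neg h, mul_neg_one]
  · simp [h]
  · rw [Real.sign_of_pos h, abs_of_pos h, mul_one]

/-! ### The total variation of a discrete measure -/

theorem discreteMeasure_apply {N : ℕ} (a : Fin N → ℝ) (x : Fin N → Torus) (η : C(Torus, ℝ)) :
    discreteMeasure a x η = ∑ i, a i * η (x i) := by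
  simp [discreteMeasure]

theorem inner_phi_discreteMeasure (φ : C2Torus) {N : ℕ} (a : Fin N → ℝ) (x : Fin N → Torus)
    (p : L2) :
    inner ℝ (Phi φ (discreteMeasure a x)) p = ∑ i, a i * PhiAdj φ p (x i) := by
  have h : Phi φ (discreteMeasure a x) = ∑ i, a i • atom φ.cont (x i) := by
    simp only [Phi, atom, ← map_smul, ← map_sum]
    congr 1
    ext t
    simp [discreteMeasure_apply]
  rw [h, sum_inner]
  simp only [inner_smul_left, phiAdj_apply]
  simp

/-- Tietze's theorem extends the signs from the distinct spikes to a test function with values in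
`[-1, 1]`. -/
theorem sum_abs_le_norm_discreteMeasure {N : ℕ} (a : Fin N → ℝ) {x : Fin N → Torus}
    (hx : Function.Injective x) : ∑ i, |a i| ≤ ‖discreteMeasure a x‖ := by
  have he : IsClosedEmbedding x :=
    IsClosedEmbedding.of_continuous_injective_isClosedMap continuous_of_discreteTopology hx
      fun s _ => (s.toFinite.image x).isClosed
  obtain ⟨η, hη, hηx⟩ := ContinuousMap.exists_extension_forall_mem_of_isClosedEmbedding
    (⟨fun i => Real.sign (a i), continuous_of_discreteTopology⟩ : C(Fin N, ℝ))
    (t := Set.Icc (-1) 1) (fun i => by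
      rcases Real.sign_apply_eq (a i) with h | h | h <;> simp [h]) ⟨0, by simp⟩ he
  have hη1 : ‖η‖ ≤ 1 := (ContinuousMap.norm_le _ zero_le_one).2 fun t => abs_le.2 (hη t)
  calc ∑ i, |a i| = discreteMeasure a x η := by
        rw [discreteMeasure_apply]
        refine Finset.sum_congr rfl fun i _ => ?_
        have : η (x i) = Real.sign (a i) := congrFun hηx i
        rw [this, mul_sign_eq_abs]
    _ ≤ ‖discreteMeasure a x η‖ := Real.le_norm_self _
    _ ≤ ‖discreteMeasure a x‖ * ‖η‖ := (discreteMeasure a x).le_opNorm η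
    _ ≤ ‖discreteMeasure a x‖ := mul_le_of_le_one_right (ContinuousLinearMap.opNorm_nonneg _) hη1

/-- Adding or subtracting a unit Dirac mass at `t` raises the norm by at most `1`, which bounds `±η
t`. -/
theorem norm_le_one_of_mem_subdiffTV {m : RadonMeasure} {η : C(Torus, ℝ)}
    (h : η ∈ subdiffTV m) : ‖η‖ ≤ 1 := by
  refine (ContinuousMap.norm_le _ zero_le_one).2 fun t => ?_
  have hδ : ‖(ContinuousMap.evalCLM ℝ t : RadonMeasure)‖ ≤ 1 :=
    ContinuousLinearMap.opNorm_le_bound _ zero_le_one fun ψ => by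
      simpa using ψ.norm_coe_le_norm t
  have h₁ := h (m + ContinuousMap.evalCLM ℝ t)
  have h₂ := h (m - ContinuousMap.evalCLM ℝ t)
  have h₁' := norm_add_le m (ContinuousMap.evalCLM ℝ t : RadonMeasure)
  have h₂' := norm_sub_le m (ContinuousMap.evalCLM ℝ t : RadonMeasure)
  simp at h₁ h₂
  exact abs_le.2 ⟨by linarith, by linarith⟩

theorem norm_le_apply_of_mem_subdiffTV {m : RadonMeasure} {η : C(Torus, ℝ)}
    (h : η ∈ subdiffTV m) : ‖m‖ ≤ m η := by
  have h₀ := h 0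
  rw [ContinuousLinearMap.opNorm_zero] at h₀
  simpa using h₀

/-! ### The dual solutions -/

theorem mul_le_abs_of_abs_le_one {a b : ℝ} (hb : |b| ≤ 1) : a * b ≤ |a| :=
  (le_abs_self _).trans (by rw [abs_mul]; exact mul_le_of_le_one_right (abs_nonneg _) hb)

theorem eq_sign_of_mul_eq_abs {a b : ℝ} (ha : a ≠ 0) (h : a * b = |a|) : b = Real.sign a :=
  mul_left_cancel₀ ha (h.trans (mul_sign_eq_abs a).symm)

/-- The dual objective is `∑ aᵢ (Φ* p)(xᵢ) ≤ ∑ |aᵢ|`. The source condition supplies a feasible point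
attaining this bound, so a maximizer has equality in every term. -/
theorem mem_dualSolutions_iff {φ : C2Torus} {N : ℕ} {a : Fin N → ℝ} {x : Fin N → Torus}
    (ha : ∀ i, a i ≠ 0) (hx : Function.Injective x)
    (hsc : SourceCondition φ (discreteMeasure a x)) (p : L2) :
    p ∈ dualSolutions φ (Phi φ (discreteMeasure a x)) ↔
      (∀ t, |PhiAdj φ p t| ≤ 1) ∧ ∀ i, PhiAdj φ p (x i) = Real.sign (a i) := by
  have hnorm (q : L2) : ‖PhiAdj φ q‖ ≤ 1 ↔ ∀ t, |PhiAdj φ q t| ≤ 1 :=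
    ContinuousMap.norm_le _ zero_le_one
  have hle (q : L2) (hq : ∀ t, |PhiAdj φ q t| ≤ 1) (i : Fin N) :
      a i * PhiAdj φ q (x i) ≤ |a i| := mul_le_abs_of_abs_le_one (hq _)
  simp only [dualSolutions, Set.mem_ofPred_eq, inner_phi_discreteMeasure, hnorm]
  refine and_congr_right fun hp => ⟨fun h i => ?_, fun h q hq => ?_⟩
  · obtain ⟨q, hq⟩ := hsc
    have h₁ := h q ((hnorm q).1 (norm_le_one_of_mem_subdiffTV hq))
    have h₂ := norm_le_apply_of_mem_subdiffTV hq
    rw [discreteMeasure_apply] at h₂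
    have h₃ := (sum_abs_le_norm_discreteMeasure a hx).trans (h₂.trans h₁)
    have h₄ := (Finset.sum_eq_sum_iff_of_le fun i _ => hle p hp i).1
      (le_antisymm (Finset.sum_le_sum fun i _ => hle p hp i) h₃)
    exact eq_sign_of_mul_eq_abs (ha i) (h₄ i (Finset.mem_univ i))
  · refine Finset.sum_le_sum fun i _ => ?_
    rw [h i, mul_sign_eq_abs]
    exact hle q hq i

/-- By strict convexity of the norm, the midpoint of two distinct minimizers would be strictly
shorter. -/
theorem IsMinNorm.eq {S : Set L2} (hS : Convex ℝ S) {p q : L2} (hp : IsMinNorm S p)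
    (hq : IsMinNorm S q) : p = q := by
  have hn : ‖p‖ = ‖q‖ := le_antisymm (hp.2 q hq.1) (hq.2 p hp.1)
  by_contra hne
  have hmid := hp.2 _ (hS hp.1 hq.1 (a := 1 / 2) (b := 1 / 2) (by norm_num) (by norm_num)
    (by norm_num))
  have hlt := norm_combo_lt_of_ne (le_refl ‖p‖) hn.ge hne (a := 1 / 2) (b := 1 / 2)
    (by norm_num) (by norm_num) (by norm_num)
  exact absurd hmid (not_le.2 hlt)

theorem existsUnique_isMinNorm {S : Set L2} (hne : S.Nonempty) (hcl : IsClosed S)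
    (hconv : Convex ℝ S) : ∃! p, IsMinNorm S p := by
  obtain ⟨p, hp, hmin⟩ := exists_norm_eq_iInf_of_complete_convex hne hcl.isComplete hconv 0
  have hpS : IsMinNorm S p := by
    refine ⟨hp, fun q hq => ?_⟩
    simp only [zero_sub, norm_neg] at hmin
    rw [hmin]
    exact ciInf_le ⟨0, by rintro _ ⟨w, rfl⟩; exact norm_nonneg _⟩ (⟨q, hq⟩ : S)
  exact ⟨p, hpS, fun q hq => hq.eq hconv hpS⟩

theorem existsUnique_isMinNorm_dualSolutions {φ : C2Torus} {N : ℕ} {a : Fin N → ℝ}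
    {x : Fin N → Torus} (ha : ∀ i, a i ≠ 0) (hx : Function.Injective x)
    (hsc : SourceCondition φ (discreteMeasure a x)) :
    ∃! p₀, IsMinNorm (dualSolutions φ (Phi φ (discreteMeasure a x))) p₀ := by
  have hS : dualSolutions φ (Phi φ (discreteMeasure a x)) =
      (⋂ t, {p | |inner ℝ (atom φ.cont t) p| ≤ 1}) ∩
        ⋂ i, {p | inner ℝ (atom φ.cont (x i)) p = Real.sign (a i)} := by
    ext p
    simp [mem_dualSolutions_iff ha hx hsc, phiAdj_apply]
  refine existsUnique_isMinNorm ?_ ?_ ?_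
  -- The source condition is what makes the dual supremum attained.
  · obtain ⟨p, hp⟩ := hsc
    refine ⟨p, norm_le_one_of_mem_subdiffTV hp, fun q hq => ?_⟩
    rw [inner_phi_discreteMeasure, inner_phi_discreteMeasure, ← discreteMeasure_apply,
      ← discreteMeasure_apply]
    calc discreteMeasure a x (PhiAdj φ q) ≤ ‖discreteMeasure a x (PhiAdj φ q)‖ :=
          Real.le_norm_self _
      _ ≤ ‖discreteMeasure a x‖ * ‖PhiAdj φ q‖ := (discreteMeasure a x).le_opNorm _
      _ ≤ ‖discreteMeasure a x‖ := mul_le_of_le_one_right (ContinuousLinearMap.opNorm_nonneg _) hq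
      _ ≤ _ := norm_le_apply_of_mem_subdiffTV hp
  · rw [hS]
    refine (isClosed_iInter fun t => ?_).inter (isClosed_iInter fun i => ?_)
    · exact isClosed_le (by fun_prop) continuous_const
    · exact isClosed_eq (by fun_prop) continuous_const
  · rw [hS]
    refine (convex_iInter fun t => ?_).inter (convex_iInter fun i => ?_)
    · simp only [abs_le, Set.ofPred_and]
      exact (convex_halfSpace_ge (innerₛₗ ℝ (atom φ.cont t)).isLinear _).inter
        (convex_halfSpace_le (innerₛₗ ℝ (atom φ.cont t)).isLinear _)
    · exact convex_hyperplane (innerₛₗ ℝ (atom φ.cont (x i))).isLinear _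

/-! ### The vanishing derivative constraints -/

theorem inner_gam (φ : C2Torus) {N : ℕ} (x : Fin N → Torus) (w : PairSpace N) (p : L2) :
    inner ℝ (Gam φ x w) p =
      ∑ i, (w.fst i * PhiAdj φ p (x i) + w.snd i * torusDeriv (PhiAdj φ p) (x i)) := by
  simp [Gam, spikeOp, torusDeriv_phiAdj, phiAdj_apply, inner_add_left,
    sum_inner, inner_smul_left, Finset.sum_add_distrib]

theorem inner_signZero {N : ℕ} (a : Fin N → ℝ) (w : PairSpace N) :
    inner ℝ w (signZero a) = ∑ i, w.fst i * Real.sign (a i) := by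
  simp [signZero, WithLp.prod_inner_apply, PiLp.inner_apply, mul_comm]

theorem mem_vanishingConstraints_iff (φ : C2Torus) {N : ℕ} (a : Fin N → ℝ) (x : Fin N → Torus)
    (p : L2) :
    p ∈ vanishingConstraints φ a x ↔ (Gam φ x).adjoint p = signZero a := by
  constructor
  · intro h
    refine ext_inner_left ℝ fun w => ?_
    rw [ContinuousLinearMap.adjoint_inner_right, inner_gam, inner_signZero]
    refine Finset.sum_congr rfl fun i _ => ?_
    rw [(h i).1, (h i).2]
    simp
  · intro h i
    have key (w : PairSpace N) : ∑ j, (w.fst j * PhiAdj φ p (x j) +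
        w.snd j * torusDeriv (PhiAdj φ p) (x j)) = ∑ j, w.fst j * Real.sign (a j) := by
      rw [← inner_gam, ← inner_signZero, ← h, ContinuousLinearMap.adjoint_inner_right]
    constructor
    · simpa using key (WithLp.toLp 2 (EuclideanSpace.single i 1, 0))
    · simpa using key (WithLp.toLp 2 (0, EuclideanSpace.single i 1))

theorem isInvertible_adjoint_comp_self {E F : Type*} [NormedAddCommGroup E]
    [InnerProductSpace ℝ E] [CompleteSpace E] [FiniteDimensional ℝ E] [NormedAddCommGroup F]
    [InnerProductSpace ℝ F] [CompleteSpace F] {A : E →L[ℝ] F} (hA : Function.Injective A) :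
    (ContinuousLinearMap.adjoint A ∘L A).IsInvertible := by
  have hinj : Function.Injective (ContinuousLinearMap.adjoint A ∘L A).toLinearMap := by
    rw [← LinearMap.ker_eq_bot, LinearMap.ker_eq_bot']
    intro w hw
    have hw' : ContinuousLinearMap.adjoint A (A w) = 0 := hw
    have h : inner ℝ w (ContinuousLinearMap.adjoint A (A w)) = (0 : ℝ) := by
      rw [hw', inner_zero_right]
    rw [ContinuousLinearMap.adjoint_inner_right, inner_self_eq_zero] at h
    exact hA (h.trans (map_zero _).symm)
  exact ⟨(LinearEquiv.ofInjectiveEndo _ hinj).toContinuousLinearEquiv,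
    ContinuousLinearMap.ext fun w => rfl⟩

theorem isInvertible_gramGam {φ : C2Torus} {N : ℕ} {x : Fin N → Torus}
    (hΓ : Function.Injective (Gam φ x)) : (gramGam φ x).IsInvertible := by
  have : FiniteDimensional ℝ (PairSpace N) :=
    (WithLp.linearEquiv 2 ℝ (EuclideanSpace ℝ (Fin N) ×
      EuclideanSpace ℝ (Fin N))).symm.finiteDimensional
  exact isInvertible_adjoint_comp_self hΓ

/-- Two feasible points differ by an element of `ker Γ*`, which is orthogonal to the range of `Γ`;
Pythagoras concludes. -/
theorem isMinNorm_vanishingConstraints {φ : C2Torus} {N : ℕ} (a : Fin N → ℝ)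
    {x : Fin N → Torus} (hΓ : Function.Injective (Gam φ x)) :
    IsMinNorm (vanishingConstraints φ a x)
      (Gam φ x ((gramGam φ x).inverse (signZero a))) := by
  set w := (gramGam φ x).inverse (signZero a)
  have hmem : (Gam φ x).adjoint (Gam φ x w) = signZero a :=
    DFunLike.congr_fun (isInvertible_gramGam hΓ).self_comp_inverse (signZero a)
  refine ⟨(mem_vanishingConstraints_iff φ a x _).2 hmem, fun q hq => ?_⟩
  rw [mem_vanishingConstraints_iff] at hq
  have horth : inner ℝ (Gam φ x w) (q - Gam φ x w) = (0 : ℝ) := by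
    rw [← ContinuousLinearMap.adjoint_inner_right, map_sub, hq, hmem, sub_self, inner_zero_right]
  have hpyth := norm_add_sq_eq_norm_sq_add_norm_sq_of_inner_eq_zero _ _ horth
  rw [add_sub_cancel] at hpyth
  nlinarith [norm_nonneg q, norm_nonneg (Gam φ x w), mul_self_nonneg ‖q - Gam φ x w‖]

theorem convex_vanishingConstraints (φ : C2Torus) {N : ℕ} (a : Fin N → ℝ) (x : Fin N → Torus) :
    Convex ℝ (vanishingConstraints φ a x) := by
  have h : vanishingConstraints φ a x = (Gam φ x).adjoint ⁻¹' {signZero a} := by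
    ext p
    simp [mem_vanishingConstraints_iff]
  rw [h]
  exact (convex_singleton _).linear_preimage (Gam φ x).adjoint.toLinearMap

/-! ### Comparison of the two certificates -/

theorem sign_mul_self_of_ne_zero {a : ℝ} (ha : a ≠ 0) : Real.sign a * Real.sign a = 1 := by
  rcases Real.sign_apply_eq_of_ne_zero a ha with h | h <;> simp [h]

theorem abs_sign_of_ne_zero {a : ℝ} (ha : a ≠ 0) : |Real.sign a| = 1 := by
  rcases Real.sign_apply_eq_of_ne_zero a ha with h | h <;> simp [h]

/-- A dual solution interpolates the signs at extrema of `Φ* p`, so `(Φ* p)'` vanishes there. -/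
theorem mem_vanishingConstraints_of_abs_le_one {φ : C2Torus} {N : ℕ} {a : Fin N → ℝ}
    {x : Fin N → Torus} (ha : ∀ i, a i ≠ 0) {p : L2} (hle : ∀ t, |PhiAdj φ p t| ≤ 1)
    (hp : ∀ i, PhiAdj φ p (x i) = Real.sign (a i)) : p ∈ vanishingConstraints φ a x := by
  refine fun i => ⟨hp i, ?_⟩
  have hpi := hp i
  rw [torusDeriv_phiAdj]
  obtain ⟨u, hu⟩ := QuotientAddGroup.mk_surjective (x i)
  rw [← hu] at hpi ⊢
  have hd := hasDerivAt_inner_atom φ.hasDerivAt_cont p u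
  simp only [phiAdj_apply] at hle hpi
  rcases Real.sign_apply_eq_of_ne_zero _ (ha i) with h | h
  · have hmin : IsLocalMin (fun v : ℝ => inner ℝ (atom φ.cont (v : Torus)) p) u :=
      Eventually.of_forall fun v => (hpi.trans h).le.trans (abs_le.1 (hle v)).1
    exact hmin.hasDerivAt_eq_zero hd
  · have hmax : IsLocalMax (fun v : ℝ => inner ℝ (atom φ.cont (v : Torus)) p) u :=
      Eventually.of_forall fun v => (abs_le.1 (hle v)).2.trans (hpi.trans h).ge
    exact hmax.hasDerivAt_eq_zero hd

/-- Compactness of the torus reduces the uniform bound to a local one in `(ε, t)`. Off the spikes it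
follows from strict inequality and continuity, at a spike from the nonzero curvature. -/
theorem eventually_abs_phiAdj_add_smul_le_one {φ : C2Torus} {N : ℕ} {a : Fin N → ℝ}
    {x : Fin N → Torus} (ha : ∀ i, a i ≠ 0) {p q : L2} (hle : ∀ t, |PhiAdj φ p t| ≤ 1)
    (hp : ∀ i, PhiAdj φ p (x i) = Real.sign (a i))
    (hlt : ∀ t, t ∉ Set.range x → |PhiAdj φ p t| < 1)
    (hne : ∀ i, torusDeriv (torusDeriv (PhiAdj φ p)) (x i) ≠ 0)
    (hq : ∀ i, PhiAdj φ q (x i) = 0) (hq' : ∀ i, torusDeriv (PhiAdj φ q) (x i) = 0) :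
    ∀ᶠ ε : ℝ in 𝓝 0, ∀ t, |PhiAdj φ (p + ε • q) t| ≤ 1 := by
  have hlin (ε : ℝ) (t : Torus) :
      PhiAdj φ (p + ε • q) t = PhiAdj φ p t + ε * PhiAdj φ q t := by
    simp [phiAdj_apply, inner_add_right, inner_smul_right]
  simp only [hlin]
  suffices h : ∀ t ∈ (Set.univ : Set Torus), ∀ᶠ z : ℝ × Torus in 𝓝 (0, t),
      |PhiAdj φ p z.2 + z.1 * PhiAdj φ q z.2| ≤ 1 by
    simpa using isCompact_univ.eventually_forall_of_forall_eventually
      (P := fun (ε : ℝ) (t : Torus) => |PhiAdj φ p t + ε * PhiAdj φ q t| ≤ 1) h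
  intro t _
  by_cases ht : t ∈ Set.range x
  · obtain ⟨i, rfl⟩ := ht
    obtain ⟨u, hu⟩ := QuotientAddGroup.mk_surjective (x i)
    replace hp := hp i
    replace hne := hne i
    replace hq := hq i
    replace hq' := hq' i
    rw [torusDeriv_torusDeriv_phiAdj] at hne
    rw [torusDeriv_phiAdj] at hq'
    rw [← hu] at hp hne hq hq' ⊢
    simp only [phiAdj_apply] at hle hp hq ⊢
    -- Multiplying by the sign turns a minimum of value `-1` into a maximum of value `1`.
    set σ := Real.sign (a i)
    have hσ : σ * σ = 1 := sign_mul_self_of_ne_zero (ha i)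
    have hσ' : |σ| = 1 := abs_sign_of_ne_zero (ha i)
    have hσ0 : σ ≠ 0 := by rintro h; simp [h] at hσ
    have hcont (r : L2) :
        Continuous fun v : ℝ => σ * inner ℝ (atom φ.contDeriv2 (v : Torus)) r := by
      have := (continuous_atom φ.contDeriv2).comp (AddCircle.continuous_mk' (1 : ℝ))
      exact continuous_const.mul (this.inner continuous_const)
    have hreal := eventually_abs_add_mul_le_one (u := u)
      (fun v => (hasDerivAt_inner_atom φ.hasDerivAt_cont p v).const_mul σ)
      (fun v => (hasDerivAt_inner_atom φ.hasDerivAt_contDeriv p v).const_mul σ) (hcont p)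
      (fun v => (hasDerivAt_inner_atom φ.hasDerivAt_cont q v).const_mul σ)
      (fun v => (hasDerivAt_inner_atom φ.hasDerivAt_contDeriv q v).const_mul σ) (hcont q)
      (fun v => (mul_le_abs_of_abs_le_one (hle v)).trans hσ'.le)
      ((congrArg (σ * ·) hp).trans hσ) (mul_ne_zero hσ0 hne)
      ((congrArg (σ * ·) hq).trans (mul_zero σ)) ((congrArg (σ * ·) hq').trans (mul_zero σ))
    -- The quotient map is open and continuous, so the estimate on `ℝ` descends to the torus.
    have hmap : 𝓝 ((0 : ℝ), (QuotientAddGroup.mk u : Torus)) =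
        map (Prod.map id (QuotientAddGroup.mk : ℝ → Torus)) (𝓝 (0, u)) := by
      have h : map (QuotientAddGroup.mk : ℝ → Torus) (𝓝 u) = 𝓝 (QuotientAddGroup.mk u) :=
        QuotientAddGroup.isOpenMap_coe.map_nhds_eq (AddCircle.continuous_mk' (1 : ℝ)).continuousAt
      rw [nhds_prod_eq, nhds_prod_eq, ← h, ← prod_map_map_eq', map_id]
    rw [hmap, eventually_map]
    filter_upwards [hreal] with z hz
    have hfac : ∀ b c : ℝ, |σ * b + z.1 * (σ * c)| = |b + z.1 * c| := fun b c => by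
      rw [show σ * b + z.1 * (σ * c) = σ * (b + z.1 * c) by ring, abs_mul, hσ', one_mul]
    rw [hfac] at hz
    exact hz
  · have hc : Continuous fun z : ℝ × Torus => |PhiAdj φ p z.2 + z.1 * PhiAdj φ q z.2| := by
      fun_prop
    refine (hc.continuousAt.eventually_lt_const (u := 1) ?_).mono fun z hz => hz.le
    simpa using hlt t ht

theorem isMinNorm_vanishingConstraints_of_isMinNorm_dualSolutions {φ : C2Torus} {N : ℕ}
    {a : Fin N → ℝ} {x : Fin N → Torus} (ha : ∀ i, a i ≠ 0) (hx : Function.Injective x)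
    (hnd : NonDegenerateSourceCondition φ a x) {p : L2}
    (hp : IsMinNorm (dualSolutions φ (Phi φ (discreteMeasure a x))) p) :
    IsMinNorm (vanishingConstraints φ a x) p := by
  obtain ⟨hlt, hne⟩ := hnd.2 _ ⟨p, hp, rfl⟩
  obtain ⟨hle, hsign⟩ := (mem_dualSolutions_iff ha hx hnd.1 p).1 hp.1
  have hpV := mem_vanishingConstraints_of_abs_le_one ha hle hsign
  refine ⟨hpV, fun q hq => ?_⟩
  have h₀ (i : Fin N) : PhiAdj φ (q - p) (x i) = 0 := by
    have h₁ := (hq i).1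
    have h₂ := (hpV i).1
    rw [phiAdj_apply] at h₁ h₂ ⊢
    rw [inner_sub_right, h₁, h₂, sub_self]
  have h₁ (i : Fin N) : torusDeriv (PhiAdj φ (q - p)) (x i) = 0 := by
    have h₁ := (hq i).2
    have h₂ := (hpV i).2
    rw [torusDeriv_phiAdj] at h₁ h₂ ⊢
    simp only [inner_sub_right, h₁, h₂, sub_self]
  have hev := eventually_abs_phiAdj_add_smul_le_one ha hle hsign hlt hne h₀ h₁
  obtain ⟨ε, hε, hε0, hε1⟩ := ((hev.filter_mono nhdsWithin_le_nhds).and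
    (Ioo_mem_nhdsGT (zero_lt_one (α := ℝ)))).exists
  have hmem : p + ε • (q - p) ∈ dualSolutions φ (Phi φ (discreteMeasure a x)) := by
    refine (mem_dualSolutions_iff ha hx hnd.1 _).2 ⟨hε, fun i => ?_⟩
    have h₂ := h₀ i
    have h₃ := hsign i
    rw [phiAdj_apply] at h₂ h₃ ⊢
    rw [inner_add_right, inner_smul_right, h₂, h₃, mul_zero, add_zero]
  have hmin := hp.2 _ hmem
  have hconv : ‖p + ε • (q - p)‖ ≤ (1 - ε) * ‖p‖ + ε * ‖q‖ := by
    rw [show p + ε • (q - p) = (1 - ε) • p + ε • q by module]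
    refine (norm_add_le _ _).trans_eq ?_
    rw [norm_smul, norm_smul, Real.norm_of_nonneg hε0.le, Real.norm_of_nonneg (by linarith)]
  -- Minimality gives `‖p‖ ≤ (1 - ε)‖p‖ + ε‖q‖`, that is `ε‖p‖ ≤ ε‖q‖`.
  exact le_of_mul_le_mul_left (by linarith) hε0

end SparseSpikes

end

theorem mainTheorem2 (φ : SparseSpikes.C2Torus) (N : ℕ) (a : Fin N → ℝ)
    (x : Fin N → SparseSpikes.Torus) (ha : ∀ i, a i ≠ 0) (hx : Function.Injective x)
    (hΓ : Function.Injective (SparseSpikes.Gam φ x))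
    (hnd : SparseSpikes.NonDegenerateSourceCondition φ a x) :
    (∃! p₀, SparseSpikes.IsMinNorm
      (SparseSpikes.dualSolutions φ (SparseSpikes.Phi φ (SparseSpikes.discreteMeasure a x))) p₀) ∧
    (∃! pV, SparseSpikes.IsMinNorm (SparseSpikes.vanishingConstraints φ a x) pV) ∧
    (SparseSpikes.gramGam φ x).IsInvertible ∧
    ∀ η₀ ηV,
      SparseSpikes.IsMinNormCertificate φ
        (SparseSpikes.Phi φ (SparseSpikes.discreteMeasure a x)) η₀ →
      SparseSpikes.IsVanishingDerivativePrecertificate φ a x ηV →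
      ηV = η₀ ∧
      η₀ = SparseSpikes.PhiAdj φ (SparseSpikes.Gam φ x
        ((SparseSpikes.gramGam φ x).inverse (SparseSpikes.signZero a))) := by
  have hV := SparseSpikes.isMinNorm_vanishingConstraints a hΓ
  have hconv := SparseSpikes.convex_vanishingConstraints φ a x
  refine ⟨SparseSpikes.existsUnique_isMinNorm_dualSolutions ha hx hnd.1,
    ⟨_, hV, fun q hq => hq.eq hconv hV⟩, SparseSpikes.isInvertible_gramGam hΓ, ?_⟩
  rintro _ _ ⟨p₀, hp₀, rfl⟩ ⟨pV, hpV, rfl⟩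
  have h₀ := SparseSpikes.isMinNorm_vanishingConstraints_of_isMinNorm_dualSolutions ha hx hnd hp₀
  exact ⟨congrArg _ (hpV.eq hconv h₀), congrArg _ (h₀.eq hconv hV)⟩
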